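/- \textbf{Theorem.} Let $\mathbb{R}^d$ carry the Euclidean norm. A randomized algorithm $M$ with $n$ inputs in $\mathbb{R}^d$ and output in $\mathbb{R}^d$ is called $\epsilon$-DP if $\Pr(M(x)\in S)\le e^{\epsilon}\Pr(M(x')\in S)$ for every event $S$ and all inputs $x=(x_1,\dots,x_n)$, $x'=(x'_1,\dots,x'_n)$ that agree except possibly at a single index. For every $\beta_0\in(0,1)$ there are constants $\alpha_0>0$ and $c>0$, depending only on $\beta_0$, and for every real $k\ge 2$ a constant $c_k>0$, depending only on $k$ and $\beta_0$, such that the following holds. Let $n\ge 0$ and $d\ge 1$ be integers, $R\ge 1$, $0<\alpha<\alpha_0$, $0<\beta\le\beta_0$ and $\epsilon>0$. Suppose that $M$ is an $\epsilon$-DP algorithm with $n$ inputs such that, for every probability distribution $D$ on $\mathbb{R}^d$ that has a mean $\mu_D=\mathbb{E}_{X\sim D}X$ with $\|\mu_D\|\le R$ and that satisfies $\mathbb{E}_{X\sim D}\,|\langle X-\mu_D,v\rangle|^k\le 1$ for every unit vector $v\in\mathbb{R}^d$, given independent samples $X_1,\dots,X_n\sim D$, the algorithm outputs with probability at least $1-\beta$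 (over the samples and its own randomness) a point $\hat\mu$ with $\|\hat\mu-\mu_D\|\le\alpha$. Then \[ n \;\ge\; c_k\,\frac{d+\log(1/\beta)}{\alpha^2} \;+\; c\left(\frac{d+\log(1/\beta)}{\alpha^{k/(k-1)}\,\epsilon}+\frac{d\log R+\log(1/\beta)}{\epsilon}\right). \] -/

import Mathlib

open MeasureTheory ProbabilityTheory

namespace PrivateMean

/-- A randomized algorithm taking `n` inputs in `X` and producing an output in `Y` is a (Markov) kernel from
`Fin n → X` to `Y`. It is `ε`-DP if changing a single input changes the probability of every
event by a factor at most `exp ε`. -/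
def IsDP {X Y : Type*} [MeasurableSpace X] [MeasurableSpace Y] {n : ℕ}
    (ε : ℝ) (M : Kernel (Fin n → X) Y) : Prop :=
  ∀ (x x' : Fin n → X) (i : Fin n), (∀ j, j ≠ i → x j = x' j) →
    ∀ S : Set Y, MeasurableSet S → M x S ≤ ENNReal.ofReal (Real.exp ε) * M x' S

/-- The mean of a measure on `ℝ^d`. -/
noncomputable def mean {d : ℕ} (D : Measure (EuclideanSpace ℝ (Fin d))) :
    EuclideanSpace ℝ (Fin d) :=
  ∫ x, x ∂D

/-- Probability distributions on `ℝ^d` that have a mean of norm at most `R` and whose `k`-th absolute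
central moment exists and is at most `1` in every direction. -/
structure BoundedMoment {d : ℕ} (R k : ℝ) (D : Measure (EuclideanSpace ℝ (Fin d))) : Prop where
  isProbabilityMeasure : IsProbabilityMeasure D
  integrable : Integrable (fun x => x) D
  norm_mean_le : ‖mean D‖ ≤ R
  integrable_moment : ∀ v : EuclideanSpace ℝ (Fin d), ‖v‖ = 1 →
    Integrable (fun x => |inner ℝ (x - mean D) v| ^ k) D
  moment_le : ∀ v : EuclideanSpace ℝ (Fin d), ‖v‖ = 1 →
    ∫ x, |inner ℝ (x - mean D) v| ^ k ∂D ≤ 1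

/-- Given `n` i.i.d. samples from any distribution in the class `BoundedMoment R k`, the
algorithm `M` outputs, with probability at least `1 - β` over the samples and its own randomness, a point
within Euclidean distance `α` of the mean. -/
def EstimatesMean {n d : ℕ} (R k α β : ℝ)
    (M : Kernel (Fin n → EuclideanSpace ℝ (Fin d)) (EuclideanSpace ℝ (Fin d))) : Prop :=
  ∀ D : Measure (EuclideanSpace ℝ (Fin d)), BoundedMoment R k D →
    ENNReal.ofReal (1 - β) ≤
      ((Measure.pi fun _ : Fin n => D).bind M) {y | ‖y - mean D‖ ≤ α}

end PrivateMean

/-! Each term comes from the same argument, `bounds_of_transfer`. Suppose one output law `ν` has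
mass at least `1 - β` near `0` and at least `δ * exp (-X)` near every point of a ball of radius `r`.
Packing disjoint `α`-balls forces `d * log (r / (2α)) ≲ X`; the mass left over by the ball at `0`
forces `log (1 / β) ≲ X`. The true `β` is needed only at `0`; elsewhere `β₀` is enough.

Three families of distributions give three costs `X`. For point masses, `r = R` and group privacy
gives `X = ε * n`. For two-point laws, `r` is a multiple of `α` and only about `n * p` samples are
nonzero, with `p ^ (k - 1) = r ^ k`, so `X` is of order `ε * n * p`. In both cases `ν = M 0`. For
Gaussians, privacy plays no role: `ν` is the output law at mean `0`, and the second moment of the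
likelihood ratio gives `X = n * r ^ 2 / σ ^ 2`. -/

namespace PrivateMean

open scoped ENNReal

/-! ### Second-moment domination -/

/-- `P` is dominated by `Q` with second moment of the likelihood ratio at most `c`. -/
def ChiSqBound {X : Type*} [MeasurableSpace X] (c : ℝ≥0∞) (P Q : Measure X) : Prop :=
  ∀ g : X → ℝ≥0∞, Measurable g → (∫⁻ x, g x ∂P) ^ 2 ≤ c * ∫⁻ x, g x ^ 2 ∂Q

theorem sq_lintegral_mul_le {X : Type*} [MeasurableSpace X] (μ : Measure X) {f g : X → ℝ≥0∞}
    (hf : Measurable f) (hg : Measurable g) :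
    (∫⁻ x, f x * g x ∂μ) ^ 2 ≤ (∫⁻ x, f x ^ 2 ∂μ) * ∫⁻ x, g x ^ 2 ∂μ := by
  have h := ENNReal.lintegral_mul_le_Lp_mul_Lq μ Real.HolderConjugate.two_two
    hf.aemeasurable hg.aemeasurable
  simp only [Pi.mul_apply, ENNReal.rpow_two] at h
  calc (∫⁻ x, f x * g x ∂μ) ^ 2
      ≤ ((∫⁻ x, f x ^ 2 ∂μ) ^ (1 / 2 : ℝ) * (∫⁻ x, g x ^ 2 ∂μ) ^ (1 / 2 : ℝ)) ^ 2 := by gcongr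
    _ = _ := by
      rw [mul_pow]
      simp only [← ENNReal.rpow_two, ← ENNReal.rpow_mul]
      norm_num

theorem ChiSqBound.map {X Y : Type*} [MeasurableSpace X] [MeasurableSpace Y] {c : ℝ≥0∞}
    {P Q : Measure X} (h : ChiSqBound c P Q) {f : X → Y} (hf : Measurable f) :
    ChiSqBound c (P.map f) (Q.map f) := by
  intro g hg
  rw [lintegral_map hg hf, lintegral_map (hg.pow_const 2) hf]
  exact h _ (hg.comp hf)

/-- Tonelli: apply the first bound to the partial integral over `Y`, then the second bound inside
the integral. No densities are needed. -/
theorem ChiSqBound.prod {X Y : Type*} [MeasurableSpace X] [MeasurableSpace Y] {c c' : ℝ≥0∞}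
    {P Q : Measure X} {P' Q' : Measure Y} [SFinite P'] [SFinite Q']
    (h : ChiSqBound c P Q) (h' : ChiSqBound c' P' Q') :
    ChiSqBound (c * c') (P.prod P') (Q.prod Q') := by
  intro g hg
  rw [lintegral_prod _ hg.aemeasurable, lintegral_prod _ (hg.pow_const 2).aemeasurable]
  refine (h _ hg.lintegral_prod_right').trans ?_
  rw [mul_assoc, ← lintegral_const_mul _ (hg.pow_const 2).lintegral_prod_right']
  gcongr with x
  exact h' _ (hg.comp measurable_prodMk_left)

theorem ChiSqBound.pi {X : Type*} [MeasurableSpace X] {n : ℕ} {c : Fin n → ℝ≥0∞}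
    {P Q : Fin n → Measure X} [∀ i, IsProbabilityMeasure (P i)] [∀ i, IsProbabilityMeasure (Q i)]
    (h : ∀ i, ChiSqBound (c i) (P i) (Q i)) :
    ChiSqBound (∏ i, c i) (Measure.pi P) (Measure.pi Q) := by
  induction n with
  | zero =>
    intro g hg
    have hc : ∀ x, g x = g isEmptyElim := fun x => congrArg g (Subsingleton.elim _ _)
    simp [lintegral_congr hc, lintegral_congr fun x => congrArg (· ^ 2) (hc x)]
  | succ n ih =>
    have h' := ((h 0).prod (ih fun i => h (Fin.succ i))).map
      (MeasurableEquiv.piFinSuccAbove (fun _ => X) (0 : Fin (n + 1))).symm.measurable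
    rw [Fin.prod_univ_succ]
    have e := (measurePreserving_piFinSuccAbove P 0).symm.map_eq
    have e' := (measurePreserving_piFinSuccAbove Q 0).symm.map_eq
    simp only [Fin.zero_succAbove] at e e'
    rwa [e, e'] at h'

-- Cauchy–Schwarz. Completing the square, the squared density at mean `m` over the density at mean
-- `0` is `exp (m ^ 2)` times the density at mean `2 * m`, whose integral is `1`.
open Real in
theorem chiSqBound_gaussianReal (m : ℝ) :
    ChiSqBound (ENNReal.ofReal (exp (m ^ 2))) (gaussianReal m 1) (gaussianReal 0 1) := by
  intro g hg
  have key : ∀ x, gaussianPDFReal m 1 x =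
      √(gaussianPDFReal 0 1 x) * √(exp (m ^ 2) * gaussianPDFReal (2 * m) 1 x) := by
    intro x
    rw [← Real.sqrt_mul (gaussianPDFReal_nonneg _ _ _), eq_comm, Real.sqrt_eq_iff_mul_self_eq
      (by have := gaussianPDFReal_nonneg 0 1 x
          have := gaussianPDFReal_nonneg (2 * m) 1 x
          positivity) (gaussianPDFReal_nonneg _ _ _)]
    simp only [gaussianPDFReal, NNReal.coe_one, mul_one]
    have : exp (-(x - m) ^ 2 / 2) * exp (-(x - m) ^ 2 / 2)
      = exp (-(x - 0) ^ 2 / 2) * (exp (m ^ 2) * exp (-(x - 2 * m) ^ 2 / 2)) := by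
      simp only [← exp_add]
      ring_nf
    linear_combination -(√(2 * π))⁻¹ ^ 2 * this
  have hsq : ∀ y : ℝ, 0 ≤ y → ENNReal.ofReal √y ^ 2 = ENNReal.ofReal y := fun y hy => by
    rw [← ENNReal.ofReal_pow (sqrt_nonneg _), sq_sqrt hy]
  have hm : ∀ m, Measurable (gaussianPDFReal m 1) := fun m => measurable_gaussianPDFReal m 1
  rw [gaussianReal_of_var_ne_zero _ one_ne_zero, gaussianReal_of_var_ne_zero _ one_ne_zero,
    lintegral_withDensity_eq_lintegral_mul _ (measurable_gaussianPDF _ _) hg,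
    lintegral_withDensity_eq_lintegral_mul _ (measurable_gaussianPDF _ _) (hg.pow_const 2)]
  have e : ∀ x, (gaussianPDF m 1 * g) x = (g x * ENNReal.ofReal √(gaussianPDFReal 0 1 x)) *
      ENNReal.ofReal √(exp (m ^ 2) * gaussianPDFReal (2 * m) 1 x) := fun x => by
    simp only [Pi.mul_apply, gaussianPDF]
    rw [key x, ENNReal.ofReal_mul (sqrt_nonneg _)]
    ring
  simp_rw [e]
  refine (sq_lintegral_mul_le _ (hg.mul (by fun_prop)) (by fun_prop)).trans_eq ?_
  rw [mul_comm]
  congr 1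
  · simp_rw [hsq _ (mul_nonneg (exp_pos _).le (gaussianPDFReal_nonneg (2 * m) 1 _)),
      ENNReal.ofReal_mul (exp_pos (m ^ 2)).le]
    rw [lintegral_const_mul _ (by fun_prop), lintegral_gaussianPDFReal_eq_one _ one_ne_zero,
      mul_one]
  · refine lintegral_congr fun x => ?_
    rw [Pi.mul_apply, mul_pow, hsq _ (gaussianPDFReal_nonneg _ _ _), mul_comm]
    rfl

/-! ### Spherical Gaussians -/

/-- The Gaussian measure with mean `v` and covariance `σ ^ 2 • 1`. -/
noncomputable def sphericalGaussian {d : ℕ} (σ : ℝ) (v : EuclideanSpace ℝ (Fin d)) :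
    Measure (EuclideanSpace ℝ (Fin d)) :=
  (stdGaussian (EuclideanSpace ℝ (Fin d))).map fun x => σ • x + v

instance isProbabilityMeasure_sphericalGaussian {d : ℕ} (σ : ℝ) (v : EuclideanSpace ℝ (Fin d)) :
    IsProbabilityMeasure (sphericalGaussian σ v) :=
  Measure.isProbabilityMeasure_map (by fun_prop)

theorem chiSqBound_stdGaussian_map_add {d : ℕ} (w : EuclideanSpace ℝ (Fin d)) :
    ChiSqBound (ENNReal.ofReal (Real.exp (‖w‖ ^ 2)))
      ((stdGaussian (EuclideanSpace ℝ (Fin d))).map fun x => x + w)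
      (stdGaussian (EuclideanSpace ℝ (Fin d))) := by
  have h := (ChiSqBound.pi fun i => chiSqBound_gaussianReal (w i)).map
    (WithLp.measurable_toLp 2 (Fin d → ℝ))
  rw [← ENNReal.ofReal_prod_of_nonneg fun _ _ => (Real.exp_pos _).le, ← Real.exp_sum] at h
  have hw : ‖w‖ ^ 2 = ∑ i, w i ^ 2 := by simp [EuclideanSpace.norm_sq_eq]
  rw [hw, ← map_pi_eq_stdGaussian]
  convert h using 1
  have e : (Measure.pi fun i => gaussianReal (w i) 1) =
      (Measure.pi fun _ : Fin d => gaussianReal 0 1).map fun x i => x i + w i := by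
    rw [Measure.pi_map_pi fun i => (measurable_add_const (w i)).aemeasurable]
    simp [gaussianReal_map_add_const]
  rw [e, Measure.map_map (by fun_prop) (by fun_prop), Measure.map_map (by fun_prop) (by fun_prop)]
  rfl

theorem chiSqBound_sphericalGaussian {d : ℕ} {σ : ℝ} (hσ : 0 < σ)
    (v : EuclideanSpace ℝ (Fin d)) :
    ChiSqBound (ENNReal.ofReal (Real.exp (‖v‖ ^ 2 / σ ^ 2)))
      (sphericalGaussian σ v) (sphericalGaussian σ 0) := by
  have h := (chiSqBound_stdGaussian_map_add (σ⁻¹ • v)).map (f := fun x => σ • x) (by fun_prop)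
  rw [Measure.map_map (by fun_prop) (by fun_prop)] at h
  convert h using 1
  · rw [norm_smul, mul_pow, norm_inv, Real.norm_of_nonneg hσ.le]
    congr 2
    field_simp
  · refine congrArg (fun f => Measure.map f _) (funext fun x => ?_)
    simp [smul_add, smul_smul, hσ.ne']
  · simp [sphericalGaussian]

theorem map_inner_stdGaussian {d : ℕ} {u : EuclideanSpace ℝ (Fin d)} (hu : ‖u‖ = 1) :
    (stdGaussian (EuclideanSpace ℝ (Fin d))).map (fun x => inner ℝ x u) = gaussianReal 0 1 := by
  have h := IsGaussian.map_eq_gaussianReal (μ := stdGaussian (EuclideanSpace ℝ (Fin d)))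
    (innerSL ℝ u)
  rw [integral_strongDual_stdGaussian, variance_dual_stdGaussian, innerSL_apply_norm, hu] at h
  simpa [real_inner_comm] using h

theorem integrable_abs_rpow_gaussianReal {k : ℝ} (hk : 0 < k) :
    Integrable (fun y : ℝ => |y| ^ k) (gaussianReal 0 1) := by
  have h := (memLp_id_gaussianReal' (μ := 0) (v := 1) (ENNReal.ofReal k)
    ENNReal.ofReal_ne_top).integrable_norm_rpow (by simpa using hk) ENNReal.ofReal_ne_top
  simpa [ENNReal.toReal_ofReal hk.le] using h

theorem mean_sphericalGaussian {d : ℕ} (σ : ℝ) (v : EuclideanSpace ℝ (Fin d)) :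
    mean (sphericalGaussian σ v) = v := by
  have hi : Integrable (fun x => x) (stdGaussian (EuclideanSpace ℝ (Fin d))) :=
    IsGaussian.integrable_id
  rw [mean, sphericalGaussian, integral_map (by fun_prop) (by fun_prop),
    integral_add (f := fun x => σ • x) (hi.smul σ) (integrable_const v), integral_smul, integral_id_stdGaussian]
  simp

theorem boundedMoment_sphericalGaussian {d : ℕ} {R k σ : ℝ} (hk : 1 ≤ k) (hσ : 0 ≤ σ)
    (hσ1 : σ ≤ 1) (hσk : σ * ∫ y, |y| ^ k ∂gaussianReal 0 1 ≤ 1)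
    {v : EuclideanSpace ℝ (Fin d)} (hv : ‖v‖ ≤ R) :
    BoundedMoment R k (sphericalGaussian σ v) := by
  have hi : Integrable (fun x => x) (stdGaussian (EuclideanSpace ℝ (Fin d))) :=
    IsGaussian.integrable_id
  have hk0 : 0 < k := by linarith
  have hpow : ∀ u x : EuclideanSpace ℝ (Fin d),
      |inner ℝ (σ • x + v - v) u| ^ k = σ ^ k * |inner ℝ x u| ^ k := fun u x => by
    rw [add_sub_cancel_right, real_inner_smul_left, abs_mul, abs_of_nonneg hσ,
      Real.mul_rpow hσ (abs_nonneg _)]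
  have hint : ∀ u : EuclideanSpace ℝ (Fin d), ‖u‖ = 1 →
      Integrable (fun x => |inner ℝ x u| ^ k) (stdGaussian (EuclideanSpace ℝ (Fin d))) := by
    intro u hu
    have h := integrable_abs_rpow_gaussianReal hk0
    rw [← map_inner_stdGaussian hu] at h
    exact h.comp_measurable (by fun_prop)
  have hmeas : ∀ u : EuclideanSpace ℝ (Fin d),
      Measurable fun x => |inner ℝ (x - v) u| ^ k := by
    intro u
    fun_prop
  constructor
  · infer_instance
  · rw [sphericalGaussian, integrable_map_measure (by fun_prop) (by fun_prop)]
    exact (hi.smul σ).add (integrable_const v)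
  · rwa [mean_sphericalGaussian]
  · intro u hu
    rw [mean_sphericalGaussian, sphericalGaussian,
      integrable_map_measure (hmeas u).aestronglyMeasurable (by fun_prop)]
    simp only [Function.comp_def, hpow]
    exact (hint u hu).const_mul _
  · intro u hu
    rw [mean_sphericalGaussian, sphericalGaussian,
      integral_map (by fun_prop) (hmeas u).aestronglyMeasurable]
    simp only [hpow]
    rw [integral_const_mul]
    have e : ∫ x, |inner ℝ x u| ^ k ∂stdGaussian (EuclideanSpace ℝ (Fin d)) =
        ∫ y, |y| ^ k ∂gaussianReal 0 1 := by
      rw [← map_inner_stdGaussian hu, integral_map (by fun_prop)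
        (Measurable.aestronglyMeasurable (by fun_prop))]
    rw [e]
    -- Since `σ ^ k ≤ σ`, a hypothesis linear in `σ` controls the moment.
    refine le_trans (mul_le_mul_of_nonneg_right ?_ (integral_nonneg fun y => by positivity)) hσk
    exact Real.rpow_le_self_of_le_one hσ hσ1 hk

/-! ### Two-point distributions -/

/-- The distribution with mean `v` that is `p⁻¹ • v` with probability `p` and `0` otherwise. -/
noncomputable def twoPoint {d : ℕ} (p : ℝ) (v : EuclideanSpace ℝ (Fin d)) :
    Measure (EuclideanSpace ℝ (Fin d)) :=
  ENNReal.ofReal (1 - p) • Measure.dirac 0 + ENNReal.ofReal p • Measure.dirac (p⁻¹ • v)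

theorem isProbabilityMeasure_twoPoint {d : ℕ} {p : ℝ} (hp : 0 ≤ p) (hp1 : p ≤ 1)
    (v : EuclideanSpace ℝ (Fin d)) : IsProbabilityMeasure (twoPoint p v) := by
  constructor
  simp [twoPoint, ← ENNReal.ofReal_add (sub_nonneg.2 hp1) hp]

theorem integrable_twoPoint {d : ℕ} {F : Type*} [NormedAddCommGroup F]
    (p : ℝ) (v : EuclideanSpace ℝ (Fin d)) (f : EuclideanSpace ℝ (Fin d) → F) :
    Integrable f (twoPoint p v) :=
  ((integrable_dirac enorm_lt_top).smul_measure ENNReal.ofReal_ne_top).add_measure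
    ((integrable_dirac enorm_lt_top).smul_measure ENNReal.ofReal_ne_top)

theorem integral_twoPoint {d : ℕ} {F : Type*} [NormedAddCommGroup F] [NormedSpace ℝ F]
    [CompleteSpace F] {p : ℝ} (hp : 0 ≤ p) (hp1 : p ≤ 1) (v : EuclideanSpace ℝ (Fin d))
    (f : EuclideanSpace ℝ (Fin d) → F) :
    ∫ x, f x ∂twoPoint p v = (1 - p) • f 0 + p • f (p⁻¹ • v) := by
  rw [twoPoint, integral_add_measure
    ((integrable_dirac enorm_lt_top).smul_measure ENNReal.ofReal_ne_top)
    ((integrable_dirac enorm_lt_top).smul_measure ENNReal.ofReal_ne_top),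
    integral_smul_measure, integral_smul_measure, integral_dirac, integral_dirac,
    ENNReal.toReal_ofReal hp, ENNReal.toReal_ofReal (sub_nonneg.2 hp1)]

theorem mean_twoPoint {d : ℕ} {p : ℝ} (hp : 0 < p) (hp1 : p ≤ 1)
    (v : EuclideanSpace ℝ (Fin d)) : mean (twoPoint p v) = v := by
  rw [mean, integral_twoPoint hp.le hp1]
  simp [smul_smul, hp.ne']

theorem twoPoint_compl_zero_le {d : ℕ} (p : ℝ) (v : EuclideanSpace ℝ (Fin d)) :
    twoPoint p v {0}ᶜ ≤ ENNReal.ofReal p := by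
  simp only [twoPoint, Measure.add_apply, Measure.smul_apply, smul_eq_mul]
  rw [Measure.dirac_apply' _ (measurableSet_singleton _).compl]
  simp only [Set.mem_compl_iff, Set.mem_singleton_iff, not_true_eq_false, not_false_eq_true,
    Set.indicator_of_notMem, mul_zero, zero_add]
  exact mul_le_of_le_one_right' prob_le_one

theorem boundedMoment_twoPoint {d : ℕ} {R k p : ℝ} (hk : 2 ≤ k) (hp : 0 < p) (hp1 : p ≤ 1)
    {v : EuclideanSpace ℝ (Fin d)} (hvR : ‖v‖ ≤ R) (hv : ‖v‖ ^ k ≤ p ^ (k - 1)) :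
    BoundedMoment R k (twoPoint p v) where
  isProbabilityMeasure := isProbabilityMeasure_twoPoint hp.le hp1 v
  integrable := integrable_twoPoint _ _ _
  norm_mean_le := by rwa [mean_twoPoint hp hp1]
  integrable_moment _ _ := integrable_twoPoint _ _ _
  moment_le u hu := by
    rw [mean_twoPoint hp hp1, integral_twoPoint hp.le hp1]
    have hq : 0 ≤ 1 - p := sub_nonneg.2 hp1
    have e1 : |inner ℝ (0 - v) u| = |inner ℝ v u| := by
      rw [zero_sub, inner_neg_left, abs_neg]
    have e2 : |inner ℝ (p⁻¹ • v - v) u| = (1 - p) / p * |inner ℝ v u| := by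
      have : p⁻¹ • v - v = ((1 - p) / p) • v := by
        rw [sub_div, div_self hp.ne', sub_smul, one_smul, one_div]
      rw [this, real_inner_smul_left, abs_mul, abs_of_nonneg (div_nonneg hq hp.le)]
    have hi : |inner ℝ v u| ^ k ≤ p ^ (k - 1) := by
      refine le_trans (Real.rpow_le_rpow (abs_nonneg _) ?_ (by linarith)) hv
      simpa [hu] using abs_real_inner_le_norm v u
    rw [e1, e2, Real.mul_rpow (div_nonneg hq hp.le) (abs_nonneg _), Real.div_rpow hq hp.le]
    simp only [smul_eq_mul]
    have hpk : p ^ k = p * p ^ (k - 1) := by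
      rw [Real.rpow_sub_one hp.ne']
      field_simp
    have h1 : (1 - p) ^ k ≤ 1 - p := Real.rpow_le_self_of_le_one hq (by linarith) (by linarith)
    have h2 : p ^ (k - 1) ≤ p := Real.rpow_le_self_of_le_one hp.le hp1 (by linarith)
    have hpos : 0 < p ^ (k - 1) := Real.rpow_pos_of_pos hp _
    have h3 : p * ((1 - p) ^ k / p ^ k * |inner ℝ v u| ^ k) ≤ (1 - p) ^ k := by
      calc p * ((1 - p) ^ k / p ^ k * |inner ℝ v u| ^ k)
          ≤ p * ((1 - p) ^ k / p ^ k * p ^ (k - 1)) := by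
            have : 0 ≤ (1 - p) ^ k / p ^ k := by positivity
            gcongr
        _ = (1 - p) ^ k := by
            rw [hpk]
            field_simp
    -- The two atoms contribute at most `(1 - p) * p` and `1 - p`, in total `1 - p ^ 2`.
    nlinarith

theorem boundedMoment_dirac {d : ℕ} {R k : ℝ} (hk : 0 < k) {v : EuclideanSpace ℝ (Fin d)}
    (hv : ‖v‖ ≤ R) : BoundedMoment R k (Measure.dirac v) where
  isProbabilityMeasure := inferInstance
  integrable := integrable_dirac enorm_lt_top
  norm_mean_le := by simpa [mean] using hv
  integrable_moment _ _ := integrable_dirac enorm_lt_top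
  moment_le u hu := by simp [mean, Real.zero_rpow hk.ne']

/-! ### Packing -/

/-- Greedy choice: by volume, fewer than `N` balls of radius `s` cannot cover the ball of radius
`r`, so another point can be added. -/
theorem exists_separated_finset {E : Type*} [NormedAddCommGroup E] [NormedSpace ℝ E]
    [FiniteDimensional ℝ E] {r s : ℝ} (hr : 0 ≤ r) (hs : 0 ≤ s) (N : ℕ)
    (hN : ∀ m : ℕ, m < N → m * s ^ Module.finrank ℝ E < r ^ Module.finrank ℝ E) :
    ∃ t : Finset E, t.card = N ∧ (∀ x ∈ t, ‖x‖ ≤ r) ∧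
      ∀ x ∈ t, ∀ y ∈ t, x ≠ y → s < dist x y := by
  classical
  borelize E
  induction N with
  | zero => exact ⟨∅, by simp⟩
  | succ N ih =>
    obtain ⟨t, ht, htr, hts⟩ := ih fun m hm => hN m (hm.trans N.lt_succ_self)
    obtain ⟨z, hzr, hz⟩ : ∃ z : E, ‖z‖ ≤ r ∧ ∀ x ∈ t, s < dist z x := by
      by_contra! hcon
      let μ : Measure E := Measure.addHaar
      have hsub : Metric.closedBall (0 : E) r ⊆ ⋃ x ∈ t, Metric.closedBall x s := fun z hz => by
        obtain ⟨x, hx, hzx⟩ := hcon z (by simpa using hz)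
        exact Set.mem_biUnion hx hzx
      have h := (measureReal_mono (μ := μ) hsub
        ((measure_biUnion_lt_top t.finite_toSet fun x _ => measure_closedBall_lt_top).ne)).trans
        (measureReal_biUnion_finset_le t _)
      simp only [Measure.addHaar_real_closedBall' μ _ hr,
        Measure.addHaar_real_closedBall' μ _ hs, Finset.sum_const, nsmul_eq_mul, ht] at h
      have hpos : 0 < μ.real (Metric.closedBall (0 : E) 1) :=
        ENNReal.toReal_pos (Metric.measure_closedBall_pos μ _ one_pos).ne'
          measure_closedBall_lt_top.ne
      rw [← mul_assoc] at h
      exact absurd (le_of_mul_le_mul_right h hpos) (not_le.2 (hN N N.lt_succ_self))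
    have hzt : z ∉ t := fun h => by simpa using (hz z h).trans_le' hs
    refine ⟨insert z t, by rw [Finset.card_insert_of_notMem hzt, ht], ?_, ?_⟩
    · simpa using ⟨hzr, htr⟩
    · intro x hx y hy hxy
      rcases Finset.mem_insert.1 hx with rfl | hxt <;> rcases Finset.mem_insert.1 hy with rfl | hyt
      · exact absurd rfl hxy
      · exact hz y hyt
      · rw [dist_comm]
        exact hz x hxt
      · exact hts x hxt y hyt hxy

theorem exists_packing {d : ℕ} {r s : ℝ} (hr : 0 ≤ r) (hs : 0 < s) :
    ∃ t : Finset (EuclideanSpace ℝ (Fin d)), (r / s) ^ d ≤ t.card ∧ (∀ x ∈ t, ‖x‖ ≤ r) ∧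
      ∀ x ∈ t, ∀ y ∈ t, x ≠ y → s < dist x y := by
  obtain ⟨t, ht, h⟩ := exists_separated_finset (E := EuclideanSpace ℝ (Fin d)) hr hs.le
    ⌈(r / s) ^ d⌉₊ fun m hm => by
      rw [finrank_euclideanSpace_fin, ← lt_div_iff₀ (by positivity), ← div_pow]
      exact Nat.lt_ceil.1 hm
  exact ⟨t, ht ▸ Nat.le_ceil _, h⟩

/-- Disjoint balls have total `ν`-mass at most `1`. A full packing yields the dimension bound; the
ball at `0` with a single ball at distance `r` yields the confidence bound. -/
theorem bounds_of_transfer {d : ℕ} {r α β δ X : ℝ} (hd : 1 ≤ d) (hα : 0 < α) (hr : 2 * α < r)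
    (hδ : 0 < δ)
    (ν : Measure (EuclideanSpace ℝ (Fin d))) [IsProbabilityMeasure ν]
    (h0 : ENNReal.ofReal (1 - β) ≤ ν (Metric.closedBall 0 α))
    (h : ∀ v : EuclideanSpace ℝ (Fin d), ‖v‖ ≤ r →
      ENNReal.ofReal (δ * Real.exp (-X)) ≤ ν (Metric.closedBall v α)) :
    d * Real.log (r / (2 * α)) + Real.log δ ≤ X ∧ Real.log (1 / β) + Real.log δ ≤ X := by
  have hr0 : 0 < r := by linarith
  have hreal : ∀ v : EuclideanSpace ℝ (Fin d), ‖v‖ ≤ r →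
      δ * Real.exp (-X) ≤ ν.real (Metric.closedBall v α) := fun v hv =>
    (ENNReal.ofReal_le_iff_le_toReal (measure_ne_top _ _)).1 (h v hv)
  have hdisj : ∀ v w : EuclideanSpace ℝ (Fin d), 2 * α < dist v w →
      Disjoint (Metric.closedBall v α) (Metric.closedBall w α) := fun v w hvw =>
    Metric.closedBall_disjoint_closedBall (by linarith)
  constructor
  · obtain ⟨t, ht, htr, hts⟩ := exists_packing (d := d) hr0.le (by linarith : 0 < 2 * α)
    have hsum : ∑ x ∈ t, ν.real (Metric.closedBall x α) ≤ 1 := by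
      rw [← measureReal_biUnion_finset (fun x hx y hy hxy => hdisj x y (hts x hx y hy hxy))
        fun _ _ => Metric.isClosed_closedBall.measurableSet]
      exact measureReal_le_one
    have h1 : (r / (2 * α)) ^ d * (δ * Real.exp (-X)) ≤ 1 := by
      refine le_trans ?_ hsum
      calc _ ≤ t.card * (δ * Real.exp (-X)) := by gcongr
        _ = ∑ x ∈ t, δ * Real.exp (-X) := by simp
        _ ≤ _ := Finset.sum_le_sum fun x hx => hreal x (htr x hx)
    have h2 := Real.log_le_log (by positivity) h1
    rw [Real.log_mul (by positivity) (by positivity), Real.log_mul hδ.ne' (Real.exp_pos _).ne',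
      Real.log_exp, Real.log_pow, Real.log_one] at h2
    linarith
  · let v : EuclideanSpace ℝ (Fin d) := EuclideanSpace.single ⟨0, hd⟩ r
    have hv : ‖v‖ = r := by simp [v, abs_of_pos hr0]
    have h0' : 1 - β ≤ ν.real (Metric.closedBall 0 α) :=
      (ENNReal.ofReal_le_iff_le_toReal (measure_ne_top _ _)).1 h0
    have h1 := measureReal_union (μ := ν) (hdisj 0 v (by rw [dist_zero_left, hv]; exact hr))
      Metric.isClosed_closedBall.measurableSet
    have h2 : ν.real (Metric.closedBall 0 α ∪ Metric.closedBall v α) ≤ 1 := measureReal_le_one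
    have h3 : δ * Real.exp (-X) ≤ β := by linarith [hreal v hv.le]
    have h4 := Real.log_le_log (by positivity) h3
    rw [Real.log_mul hδ.ne' (Real.exp_pos _).ne', Real.log_exp] at h4
    rw [one_div, Real.log_inv]
    linarith

/-! ### Group privacy -/

/-- Change the coordinates in `s` one at a time; each change costs a factor `exp ε`. -/
theorem IsDP.le_of_eqOn_compl {X Y : Type*} [MeasurableSpace X] [MeasurableSpace Y] {n : ℕ}
    {ε : ℝ} {M : Kernel (Fin n → X) Y} (hM : IsDP ε M) {S : Set Y} (hS : MeasurableSet S)
    (s : Finset (Fin n)) (x x' : Fin n → X) (h : ∀ j, j ∉ s → x j = x' j) :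
    M x S ≤ ENNReal.ofReal (Real.exp (ε * s.card)) * M x' S := by
  induction s using Finset.induction_on generalizing x with
  | empty =>
    rw [funext fun j => h j (Finset.notMem_empty j)]
    simp
  | insert i s hi ih =>
    have h1 := hM x (Function.update x i (x' i)) i
      (fun j hj => (Function.update_of_ne hj _ _).symm) S hS
    have h2 := ih (Function.update x i (x' i)) fun j hj => by
      by_cases hji : j = i
      · subst hji
        simp
      · rw [Function.update_of_ne hji]
        exact h j (by simp [hji, hj])
    refine (h1.trans (mul_le_mul_right h2 _)).trans_eq ?_
    rw [← mul_assoc, ← ENNReal.ofReal_mul (Real.exp_pos _).le, ← Real.exp_add,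
      Finset.card_insert_of_notMem hi]
    push_cast
    ring_nf

/-! ### Lower bounds on the sample size -/

theorem EstimatesMean.le_closedBall {n d : ℕ} {R k α β β₀ : ℝ}
    {M : Kernel (Fin n → EuclideanSpace ℝ (Fin d)) (EuclideanSpace ℝ (Fin d))}
    (hM : EstimatesMean R k α β M) (hβ : β ≤ β₀) {D : Measure (EuclideanSpace ℝ (Fin d))}
    (hD : BoundedMoment R k D) :
    ENNReal.ofReal (1 - β₀) ≤
      ∫⁻ x, M x (Metric.closedBall (mean D) α) ∂Measure.pi fun _ : Fin n => D := by
  rw [← Measure.bind_apply Metric.isClosed_closedBall.measurableSet M.measurable.aemeasurable]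
  refine (ENNReal.ofReal_le_ofReal (by linarith)).trans ((hM D hD).trans_eq ?_)
  congr 1

/-- Samples from the point mass at `0` form the zero data set almost surely, so `M 0` can serve as
the reference law `ν`. -/
theorem EstimatesMean.le_apply_zero {n d : ℕ} {R k α β : ℝ} (hR : 0 ≤ R) (hk : 0 < k)
    {M : Kernel (Fin n → EuclideanSpace ℝ (Fin d)) (EuclideanSpace ℝ (Fin d))}
    (hM : EstimatesMean R k α β M) :
    ENNReal.ofReal (1 - β) ≤ M 0 (Metric.closedBall 0 α) := by
  have h := hM.le_closedBall le_rfl (boundedMoment_dirac hk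
    (v := (0 : EuclideanSpace ℝ (Fin d))) (by simpa using hR))
  have h0 : ∀ᵐ x ∂Measure.pi fun _ : Fin n => Measure.dirac (0 : EuclideanSpace ℝ (Fin d)),
      x = 0 := by
    have : ∀ i : Fin n,
        ∀ᵐ x ∂Measure.pi fun _ : Fin n => Measure.dirac (0 : EuclideanSpace ℝ (Fin d)),
          x i = 0 := fun i =>
      (Measure.tendsto_eval_ae_ae (i := i)
        (μ := fun _ : Fin n => Measure.dirac (0 : EuclideanSpace ℝ (Fin d)))).eventually
        (p := fun y => y = 0) (by simp [ae_dirac_eq])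
    filter_upwards [ae_all_iff.2 this] with x hx
    exact funext hx
  have e : mean (Measure.dirac (0 : EuclideanSpace ℝ (Fin d))) = 0 := by simp [mean]
  rw [e, lintegral_congr_ae (g := fun _ => M 0 (Metric.closedBall 0 α))
    (h0.mono fun x hx => by simp only [hx])] at h
  simpa using h

/-- Group privacy with Markov's inequality: with at most `T` nonzero samples, compare with the zero
data set; otherwise bound the probability by `1`, hence by the count over `T`. The expected count is
at most `n * p`. -/
theorem IsDP.lintegral_pi_le {E Y : Type*} [MeasurableSpace E] [MeasurableSingletonClass E]
    [Zero E] [MeasurableSpace Y] {n : ℕ} {ε p T : ℝ} (hε : 0 ≤ ε) (hT : 0 < T)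
    {M : Kernel (Fin n → E) Y} [IsMarkovKernel M] (hM : IsDP ε M)
    (D : Measure E) [IsProbabilityMeasure D] (hD : D {0}ᶜ ≤ ENNReal.ofReal p)
    {S : Set Y} (hS : MeasurableSet S) :
    ∫⁻ x, M x S ∂(Measure.pi fun _ : Fin n => D) ≤
      ENNReal.ofReal (Real.exp (ε * T)) * M 0 S + ENNReal.ofReal (n * p / T) := by
  classical
  have hmeas : MeasurableSet ({0}ᶜ : Set E) := (measurableSet_singleton 0).compl
  let f : Fin n → (Fin n → E) → ℝ≥0∞ := fun i x => ({0}ᶜ : Set E).indicator 1 (x i)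
  have hf : ∀ i, Measurable (f i) := fun i =>
    (measurable_one.indicator hmeas).comp (measurable_pi_apply i)
  have hint : ∀ i, ∫⁻ x, f i x ∂(Measure.pi fun _ : Fin n => D) ≤ ENNReal.ofReal p := fun i => by
    have h := (measurePreserving_eval (fun _ : Fin n => D) i).lintegral_comp
      (measurable_one.indicator hmeas)
    rw [lintegral_indicator_one hmeas] at h
    exact h.le.trans hD
  have hpt : ∀ x, M x S ≤ ENNReal.ofReal (Real.exp (ε * T)) * M 0 S +
      ENNReal.ofReal T⁻¹ * ∑ i, f i x := by
    intro x
    let s : Finset (Fin n) := {i | x i ≠ 0}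
    have hs : ∑ i, f i x = s.card := by
      simp [f, s, Set.indicator_apply, Finset.sum_ite, Finset.filter_not]
    by_cases hc : (s.card : ℝ) ≤ T
    · refine le_add_right ((hM.le_of_eqOn_compl hS s x 0 fun j hj => ?_).trans ?_)
      · simpa [s] using hj
      · gcongr
    · refine le_add_left (prob_le_one.trans ?_)
      rw [hs, ← ENNReal.ofReal_natCast, ← ENNReal.ofReal_mul (by positivity),
        ENNReal.one_le_ofReal, inv_mul_eq_div, one_le_div hT]
      exact (not_le.1 hc).le
  calc ∫⁻ x, M x S ∂(Measure.pi fun _ : Fin n => D)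
      ≤ ∫⁻ x, (ENNReal.ofReal (Real.exp (ε * T)) * M 0 S + ENNReal.ofReal T⁻¹ * ∑ i, f i x)
          ∂(Measure.pi fun _ : Fin n => D) := lintegral_mono hpt
    _ = ENNReal.ofReal (Real.exp (ε * T)) * M 0 S + ENNReal.ofReal T⁻¹ *
          ∑ i, ∫⁻ x, f i x ∂(Measure.pi fun _ : Fin n => D) := by
        rw [lintegral_add_left measurable_const, lintegral_const_mul _
          (Finset.measurable_sum _ fun i _ => hf i), lintegral_finsetSum _ fun i _ => hf i]
        simp
    _ ≤ ENNReal.ofReal (Real.exp (ε * T)) * M 0 S + ENNReal.ofReal T⁻¹ *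
          ∑ _i : Fin n, ENNReal.ofReal p := by
        gcongr with i
        exact hint i
    _ = _ := by
        rw [Finset.sum_const, nsmul_eq_mul, Finset.card_univ, Fintype.card_fin,
          ← ENNReal.ofReal_natCast, ← ENNReal.ofReal_mul (by positivity),
          ← ENNReal.ofReal_mul (by positivity)]
        congr 2
        ring

/-- Point masses: accuracy over a ball of radius `R` costs `ε * n`. -/
theorem bounds_of_dirac {n d : ℕ} {R k α β β₀ ε δ : ℝ} (hd : 1 ≤ d) (hk : 0 < k) (hα : 0 < α)
    (hR : 2 * α < R) (hβ : β ≤ β₀) (hδ : 0 < δ) (hδ' : δ ≤ 1 - β₀)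
    {M : Kernel (Fin n → EuclideanSpace ℝ (Fin d)) (EuclideanSpace ℝ (Fin d))}
    [IsMarkovKernel M] (hdp : IsDP ε M) (hM : EstimatesMean R k α β M) :
    d * Real.log (R / (2 * α)) + Real.log δ ≤ ε * n ∧
      Real.log (1 / β) + Real.log δ ≤ ε * n := by
  refine bounds_of_transfer hd hα hR hδ (M 0) (hM.le_apply_zero (by linarith) hk) fun v hv => ?_
  have h := hM.le_closedBall hβ (boundedMoment_dirac hk hv)
  have e : mean (Measure.dirac v) = v := by simp [mean]
  rw [e] at h
  have h1 : ∫⁻ x, M x (Metric.closedBall v α) ∂(Measure.pi fun _ : Fin n => Measure.dirac v) ≤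
      ENNReal.ofReal (Real.exp (ε * n)) * M 0 (Metric.closedBall v α) := by
    refine (lintegral_mono fun x => hdp.le_of_eqOn_compl
      Metric.isClosed_closedBall.measurableSet Finset.univ x 0 (by simp)).trans_eq ?_
    simp
  rw [mul_comm δ, ENNReal.ofReal_mul (Real.exp_pos _).le]
  calc ENNReal.ofReal (Real.exp (-(ε * n))) * ENNReal.ofReal δ
      ≤ ENNReal.ofReal (Real.exp (-(ε * n))) *
          (ENNReal.ofReal (Real.exp (ε * n)) * M 0 (Metric.closedBall v α)) := by
        gcongr
        exact (ENNReal.ofReal_le_ofReal hδ').trans (h.trans h1)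
    _ = _ := by
        rw [← mul_assoc, ← ENNReal.ofReal_mul (Real.exp_pos _).le, ← Real.exp_add]
        simp

/-- Two-point distributions: only the fraction `p` of the samples is informative. -/
theorem bounds_of_twoPoint {n d : ℕ} {R k α β β₀ ε δ p r : ℝ} (hn : 0 < n) (hd : 1 ≤ d)
    (hk : 2 ≤ k) (hα : 0 < α) (hr : 2 * α < r) (hrR : r ≤ R) (hp : 0 < p) (hp1 : p ≤ 1)
    (hrp : r ^ k ≤ p ^ (k - 1)) (hβ : β ≤ β₀) (hβ₀ : β₀ < 1) (hε : 0 ≤ ε) (hδ : 0 < δ)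
    (hδ' : δ ≤ (1 - β₀) / 2)
    {M : Kernel (Fin n → EuclideanSpace ℝ (Fin d)) (EuclideanSpace ℝ (Fin d))}
    [IsMarkovKernel M] (hdp : IsDP ε M) (hM : EstimatesMean R k α β M) :
    d * Real.log (r / (2 * α)) + Real.log δ ≤ ε * (2 * n * p / (1 - β₀)) ∧
      Real.log (1 / β) + Real.log δ ≤ ε * (2 * n * p / (1 - β₀)) := by
  have hn' : (0 : ℝ) < n := Nat.cast_pos.2 hn
  have hβ' : 0 < 1 - β₀ := sub_pos.2 hβ₀
  refine bounds_of_transfer hd hα hr hδ (M 0)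
    (hM.le_apply_zero (by linarith) (by linarith)) fun v hv => ?_
  -- With this `T`, Markov's inequality loses exactly half of the success probability `1 - β₀`.
  set T := 2 * n * p / (1 - β₀) with hTdef
  have hT : 0 < T := by positivity
  have := isProbabilityMeasure_twoPoint hp.le hp1 v
  have h := hM.le_closedBall hβ (boundedMoment_twoPoint hk hp hp1 (hv.trans hrR)
    ((Real.rpow_le_rpow (norm_nonneg _) hv (by linarith)).trans hrp))
  rw [mean_twoPoint hp hp1] at h
  have h1 := h.trans (hdp.lintegral_pi_le hε hT (twoPoint p v) (twoPoint_compl_zero_le p v)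
    Metric.isClosed_closedBall.measurableSet)
  have e : n * p / T = (1 - β₀) / 2 := by
    rw [hTdef]
    field_simp
  rw [e, ← tsub_le_iff_right, ← ENNReal.ofReal_sub _ (by linarith), sub_half] at h1
  rw [mul_comm δ, ENNReal.ofReal_mul (Real.exp_pos _).le]
  calc ENNReal.ofReal (Real.exp (-(ε * T))) * ENNReal.ofReal δ
      ≤ ENNReal.ofReal (Real.exp (-(ε * T))) *
          (ENNReal.ofReal (Real.exp (ε * T)) * M 0 (Metric.closedBall v α)) := by
        gcongr
        exact (ENNReal.ofReal_le_ofReal hδ').trans (by simpa [sub_half] using h1)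
    _ = _ := by
        rw [← mul_assoc, ← ENNReal.ofReal_mul (Real.exp_pos _).le, ← Real.exp_add]
        simp

/-- Tensorize and test against `x ↦ M x S`, which is at most `1` and so dominates its square. -/
theorem ChiSqBound.sq_lintegral_kernel_le {X Y : Type*} [MeasurableSpace X] [MeasurableSpace Y]
    {n : ℕ} {c : ℝ≥0∞} {P Q : Measure X} [IsProbabilityMeasure P] [IsProbabilityMeasure Q]
    (h : ChiSqBound c P Q) (M : Kernel (Fin n → X) Y) [IsMarkovKernel M]
    {S : Set Y} (hS : MeasurableSet S) :
    (∫⁻ x, M x S ∂(Measure.pi fun _ : Fin n => P)) ^ 2 ≤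
      c ^ n * ∫⁻ x, M x S ∂(Measure.pi fun _ : Fin n => Q) := by
  have h1 := (ChiSqBound.pi fun _ : Fin n => h) _ (M.measurable_coe hS)
  rw [Finset.prod_const, Finset.card_univ, Fintype.card_fin] at h1
  refine h1.trans ?_
  gcongr with x
  rw [sq]
  exact mul_le_of_le_one_left' prob_le_one

/-- Gaussians: the sampling error, irrespective of privacy. -/
theorem bounds_of_gaussian {n d : ℕ} {R k α β β₀ δ σ r : ℝ} (hd : 1 ≤ d)
    (hk : 1 ≤ k) (hα : 0 < α) (hr : 2 * α < r) (hrR : r ≤ R) (hσ : 0 < σ) (hσ1 : σ ≤ 1)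
    (hσk : σ * ∫ y, |y| ^ k ∂gaussianReal 0 1 ≤ 1) (hβ : β ≤ β₀) (hβ₀ : β₀ < 1) (hδ : 0 < δ)
    (hδ' : δ ≤ (1 - β₀) ^ 2)
    {M : Kernel (Fin n → EuclideanSpace ℝ (Fin d)) (EuclideanSpace ℝ (Fin d))}
    [IsMarkovKernel M] (hM : EstimatesMean R k α β M) :
    d * Real.log (r / (2 * α)) + Real.log δ ≤ n * (r ^ 2 / σ ^ 2) ∧
      Real.log (1 / β) + Real.log δ ≤ n * (r ^ 2 / σ ^ 2) := by
  have hb : ∀ v : EuclideanSpace ℝ (Fin d), ‖v‖ ≤ r → BoundedMoment R k (sphericalGaussian σ v) :=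
    fun v hv => boundedMoment_sphericalGaussian hk hσ.le hσ1 hσk (hv.trans hrR)
  let ν := M ∘ₘ Measure.pi fun _ : Fin n => sphericalGaussian σ (0 : EuclideanSpace ℝ (Fin d))
  have hν : ∀ v : EuclideanSpace ℝ (Fin d), ν (Metric.closedBall v α) =
      ∫⁻ x, M x (Metric.closedBall v α) ∂Measure.pi fun _ : Fin n => sphericalGaussian σ 0 :=
    fun v => Measure.bind_apply Metric.isClosed_closedBall.measurableSet M.measurable.aemeasurable
  refine bounds_of_transfer hd hα hr hδ ν ?_ fun v hv => ?_
  · have h := hM.le_closedBall le_rfl (hb 0 (by simp; linarith))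
    rwa [mean_sphericalGaussian, ← hν] at h
  · have h := hM.le_closedBall hβ (hb v hv)
    rw [mean_sphericalGaussian] at h
    have h1 := (chiSqBound_sphericalGaussian hσ v).sq_lintegral_kernel_le M
      (Metric.isClosed_closedBall (x := v) (ε := α)).measurableSet
    rw [← hν, ← ENNReal.ofReal_pow (Real.exp_pos _).le, ← Real.exp_nat_mul] at h1
    have h2 : ENNReal.ofReal δ ≤ ENNReal.ofReal (Real.exp (n * (r ^ 2 / σ ^ 2))) *
        ν (Metric.closedBall v α) := by
      calc ENNReal.ofReal δ ≤ ENNReal.ofReal (1 - β₀) ^ 2 := by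
            rw [← ENNReal.ofReal_pow (by linarith)]
            exact ENNReal.ofReal_le_ofReal hδ'
        _ ≤ _ := pow_le_pow_left' h 2
        _ ≤ _ := h1
        _ ≤ _ := by gcongr
    rw [mul_comm δ, ENNReal.ofReal_mul (Real.exp_pos _).le]
    refine (mul_le_mul_right h2 _).trans_eq ?_
    rw [← mul_assoc, ← ENNReal.ofReal_mul (Real.exp_pos _).le, ← Real.exp_add]
    simp

end PrivateMean

/-! ### Choice of constants and assembly of the three bounds -/

open PrivateMean in
theorem mainTheorem8 (β₀ : ℝ) (hβ₀ : 0 < β₀) (hβ₀' : β₀ < 1) :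
    ∃ α₀ : ℝ, 0 < α₀ ∧ ∃ c : ℝ, 0 < c ∧
      ∀ k : ℝ, 2 ≤ k → ∃ ck : ℝ, 0 < ck ∧
        ∀ (n d : ℕ) (R α β ε : ℝ), 1 ≤ d → 1 ≤ R → 0 < α → α < α₀ →
          0 < β → β ≤ β₀ → 0 < ε →
          ∀ (M : Kernel (Fin n → EuclideanSpace ℝ (Fin d)) (EuclideanSpace ℝ (Fin d)))
            [IsMarkovKernel M],
            PrivateMean.IsDP ε M → PrivateMean.EstimatesMean R k α β M →
            ck * ((d + Real.log (1 / β)) / α ^ 2) +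
              c * ((d + Real.log (1 / β)) / (α ^ (k / (k - 1)) * ε) +
                (d * Real.log R + Real.log (1 / β)) / ε) ≤ (n : ℝ) := by
  have hβ' : 0 < 1 - β₀ := sub_pos.2 hβ₀'
  -- A single `δ` small enough for all three families.
  set δ : ℝ := ((1 - β₀) / 2) ^ 2 with hδdef
  have hδ : 0 < δ := by positivity
  have hδ2 : δ ≤ (1 - β₀) / 2 := by rw [hδdef]; nlinarith
  have hδ1 : δ ≤ 1 - β₀ := by linarith
  have hδ3 : δ ≤ (1 - β₀) ^ 2 := by rw [hδdef]; nlinarith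
  obtain ⟨A, hA⟩ : ∃ A, A = -Real.log δ := ⟨_, rfl⟩
  have hA0 : 0 < A := by
    have := Real.log_neg hδ (by linarith)
    linarith
  -- At radius `K * α` the two transfer bounds add up to `d * (2 * A + 1) + log (1 / β) - 2 * A ≤ 2
  -- * X`; as `d ≥ 1`, the terms in `A` drop out.
  obtain ⟨K, hK⟩ : ∃ K, K = 2 * Real.exp (2 * A + 1) := ⟨_, rfl⟩
  have hK2 : 2 < K := by
    have := Real.one_lt_exp_iff.2 (by linarith : 0 < 2 * A + 1)
    linarith
  have hlogK : Real.log (K / 2) = 2 * A + 1 := by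
    rw [hK, mul_div_cancel_left₀ _ two_ne_zero, Real.log_exp]
  -- `α₀ = 1 / K` keeps the radius `K * α` below `1 ≤ R`. The constants make each of the three terms
  -- at most `n / 3`.
  refine ⟨1 / K, by positivity, (1 - β₀) / (12 * K ^ 2), by positivity, fun k hk => ?_⟩
  obtain ⟨m, hm⟩ : ∃ m, m = ∫ y, |y| ^ k ∂gaussianReal 0 1 := ⟨_, rfl⟩
  have hm0 : 0 ≤ m := hm ▸ integral_nonneg fun y => by positivity
  -- The Gaussian scale is the only source of dependence on `k` in the constants.
  obtain ⟨σ, hσdef⟩ : ∃ σ, σ = 1 / (1 + m) := ⟨_, rfl⟩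
  have hσ : 0 < σ := by rw [hσdef]; positivity
  have hσ1 : σ ≤ 1 := by rw [hσdef, div_le_one (by positivity)]; linarith
  have hσm : σ * m ≤ 1 := by
    rw [hσdef, div_mul_eq_mul_div, div_le_one (by positivity)]
    linarith
  refine ⟨σ ^ 2 / (6 * K ^ 2), by positivity, ?_⟩
  intro n d R α β ε hd hR hα hα₀ hβ hββ hε M _ hdp hM
  have hd' : (1 : ℝ) ≤ d := Nat.one_le_cast.2 hd
  have hKα : K * α < 1 := by
    rw [lt_div_iff₀ (by linarith)] at hα₀
    linarith
  have hlogβ : 0 < Real.log (1 / β) :=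
    Real.log_pos (by rw [lt_div_iff₀ hβ]; linarith)
  have hlogr : Real.log (K * α / (2 * α)) = 2 * A + 1 := by
    rw [mul_div_mul_right _ _ hα.ne', hlogK]
  have hlogR : Real.log R + (2 * A + 1) ≤ Real.log (R / (2 * α)) := by
    rw [← hlogK, ← Real.log_mul (by positivity) (by positivity)]
    refine Real.log_le_log (by positivity) ?_
    rw [le_div_iff₀ (by positivity)]
    linarith [mul_le_of_le_one_right (zero_le_one.trans hR) hKα.le]
  have hAd : A ≤ d * A := le_mul_of_one_le_left hA0.le hd'
  have hlogR0 : 0 ≤ Real.log R := Real.log_nonneg hR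
  -- The range of the mean.
  obtain ⟨hC1, hC2⟩ := bounds_of_dirac hd (by linarith) hα
    (by linarith [mul_lt_mul_of_pos_right hK2 hα]) hββ hδ hδ1 hdp hM
  have hC : d * Real.log R + Real.log (1 / β) ≤ 2 * (ε * n) := by
    linarith [mul_le_mul_of_nonneg_left hlogR (Nat.cast_nonneg (α := ℝ) d)]
  -- For `n = 0` the bound just obtained contradicts `log (1 / β) > 0`.
  have hn : 0 < n := by
    rcases Nat.eq_zero_or_pos n with rfl | h
    · have : 0 ≤ d * Real.log R := by positivity
      simp only [Nat.cast_zero, mul_zero] at hC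
      linarith
    · exact h
  have hn' : (0 : ℝ) < n := Nat.cast_pos.2 hn
  -- Sampling error.
  obtain ⟨hG1, hG2⟩ := bounds_of_gaussian (k := k) hd (by linarith) hα
    (mul_lt_mul_of_pos_right hK2 hα) (by linarith) hσ hσ1 (hm ▸ hσm) hββ hβ₀' hδ hδ3 hM
  rw [hlogr] at hG1
  have hG : d + Real.log (1 / β) ≤ 2 * (n * ((K * α) ^ 2 / σ ^ 2)) := by linarith
  -- Heavy tails.
  obtain ⟨p, hpdef⟩ : ∃ p, p = (K * α) ^ (k / (k - 1)) := ⟨_, rfl⟩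
  have hKα0 : 0 < K * α := by positivity
  have hk1 : 0 < k - 1 := by linarith
  have hp : 0 < p := hpdef ▸ Real.rpow_pos_of_pos hKα0 _
  have hp1 : p ≤ 1 := hpdef ▸ Real.rpow_le_one hKα0.le hKα.le (by positivity)
  have hpk : (K * α) ^ k ≤ p ^ (k - 1) := by
    rw [hpdef, ← Real.rpow_mul hKα0.le, div_mul_cancel₀ _ hk1.ne']
  -- `k / (k - 1) ≤ 2` for `k ≥ 2`, which keeps `c` independent of `k`.
  have hpK : p ≤ K ^ 2 * α ^ (k / (k - 1)) := by
    rw [hpdef, Real.mul_rpow (by linarith) hα.le, ← Real.rpow_two]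
    gcongr
    · linarith
    · rw [div_le_iff₀ hk1]
      linarith
  obtain ⟨hT1, hT2⟩ := bounds_of_twoPoint hn hd hk hα (mul_lt_mul_of_pos_right hK2 hα)
    (by linarith) hp hp1 hpk hββ hβ₀' hε.le hδ hδ2 hdp hM
  rw [hlogr] at hT1
  have hT : d + Real.log (1 / β) ≤ 2 * (ε * (2 * n * p / (1 - β₀))) := by linarith
  have hαk : 0 < α ^ (k / (k - 1)) := Real.rpow_pos_of_pos hα _
  have b1 : σ ^ 2 / (6 * K ^ 2) * ((d + Real.log (1 / β)) / α ^ 2) ≤ n / 3 := by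
    calc _ ≤ σ ^ 2 / (6 * K ^ 2) * (2 * (n * ((K * α) ^ 2 / σ ^ 2)) / α ^ 2) := by gcongr
      _ = n / 3 := by field_simp; norm_num
  have b2 : (1 - β₀) / (12 * K ^ 2) * ((d + Real.log (1 / β)) / (α ^ (k / (k - 1)) * ε))
      ≤ n / 3 := by
    calc _ ≤ (1 - β₀) / (12 * K ^ 2) * (2 * (ε * (2 * n * (K ^ 2 * α ^ (k / (k - 1)))
            / (1 - β₀))) / (α ^ (k / (k - 1)) * ε)) := by
          have := hT.trans (by gcongr :
            _ ≤ 2 * (ε * (2 * n * (K ^ 2 * α ^ (k / (k - 1))) / (1 - β₀))))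
          gcongr
      _ = n / 3 := by field_simp; norm_num
  have b3 : (1 - β₀) / (12 * K ^ 2) * ((d * Real.log R + Real.log (1 / β)) / ε) ≤ n / 3 := by
    have hc : (1 - β₀) / (12 * K ^ 2) ≤ 1 / 6 := by
      rw [div_le_div_iff₀ (by positivity) (by norm_num)]
      linarith [one_le_pow₀ (by linarith : 1 ≤ K) (n := 2)]
    calc _ ≤ 1 / 6 * (2 * (ε * n) / ε) := by gcongr
      _ = n / 3 := by field_simp; norm_num
  rw [mul_add]
  linarith
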